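/- Let $(\eta_t)_{t\ge 0}$ be the multi-type TASEP on $\mathbb{Z}$ started from $\eta_0(x)=-x$ for all $x\in\mathbb{Z}$: $\eta_t(x)\in\mathbb{Z}$ is the type of the particle at position $x$ at time $t$, each pair of neighboring sites $(x,x+1)$ carries an independent exponential clock of rate $1$, and when the clock of $(x,x+1)$ rings, the values at $x$ and $x+1$ are swapped if they are in strictly decreasing order (i.e. $\eta(x)>\eta(x+1)$), and nothing happens otherwise. For $k\in\mathbb{Z}$, the particle of type $i\ge k$ is the $k$-leader at time $t$ if $\eta_t^{-1}(i)\ge\eta_t^{-1}(z)$ for all $z\ge k$, where $\eta_t^{-1}(i)$ is the position of the particle of type $i$. Then for all integers $k_1<k_2$, every $t\ge 0$ and every $R>1$, $$ \mathrm{Prob}\bigl(\text{the } k_1\text{-leader at time } t \text{ has type} \ge k_2\bigr) =\frac{1}{2\pi \mathrm{i}}\oint_{|w|=R}\frac{w+2}{w}\,(1+w)^{k_1-k_2-1}\exp\left(\frac{t w^2}{1+w}\right)dw, $$ where the circle is positively oriented. -/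

import Mathlib

open MeasureTheory ProbabilityTheory Filter Topology
open scoped NNReal

/-- `N` is a Poisson process of rate `1` under `P`, i.e. the counting process of an exponential
clock of rate `1`: `N t ω` is the number of rings of the clock during `(0, t]`. -/
structure IsRateOneClock {Ω : Type*} [MeasurableSpace Ω] (N : ℝ≥0 → Ω → ℕ) (P : Measure Ω) :
    Prop where
  measurable : ∀ t, Measurable (N t)
  zero : ∀ᵐ ω ∂P, N 0 ω = 0
  monotone : ∀ᵐ ω ∂P, Monotone fun t => N t ω
  rightCont : ∀ᵐ ω ∂P, ∀ t, ContinuousWithinAt (fun s => N s ω) (Set.Ici t) t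
  indepIncrements : HasIndepIncrements N P
  law : ∀ s t, s ≤ t → P.map (fun ω => N t ω - N s ω) = poissonMeasure (t - s)

/-- The clocks are indexed by `x : ℤ`, with clock `x` attached to the pair of sites `(x, x + 1)`;
they are jointly independent exponential clocks of rate `1`. -/
structure IsClockFamily {Ω : Type*} [MeasurableSpace Ω] (N : ℤ → ℝ≥0 → Ω → ℕ) (P : Measure Ω) :
    Prop where
  clock : ∀ x, IsRateOneClock (N x) P
  indep : iIndepFun (fun (x : ℤ) (ω : Ω) (t : ℝ≥0) => N x t ω) P

/-- The clock with counting path `n` rings at time `t` (its counting path jumps at `t`). -/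
def RingsAt (n : ℝ≥0 → ℕ) (t : ℝ≥0) : Prop :=
  0 < t ∧ ∀ s < t, n s < n t

/-- The configuration after the clock of the pair `(x, x + 1)` has rung in configuration `η`:
the values at `x` and `x + 1` are swapped if they are in strictly decreasing order, and
nothing happens otherwise. -/
def tasepUpdate (x : ℤ) (η : ℤ → ℤ) : ℤ → ℤ :=
  if η (x + 1) < η x then η ∘ Equiv.swap x (x + 1) else η

/-- `η : ℝ≥0 → (ℤ → ℤ)` is the path of the multi-type TASEP driven by the clocks with counting
paths `n`, started from `η_0(x) = -x`; here `η t x` is the type of the particle at position `x`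
at time `t`. A site keeps its particle as long as neither of the two adjacent clocks rings, and
when the clock of `(x, x + 1)` rings, the pair of values at `x` and `x + 1` immediately before
the ring is updated. -/
structure IsTasepPath (n : ℤ → ℝ≥0 → ℕ) (η : ℝ≥0 → ℤ → ℤ) : Prop where
  init : ∀ x, η 0 x = -x
  stay : ∀ (x : ℤ) (s t : ℝ≥0), s ≤ t → n (x - 1) s = n (x - 1) t → n x s = n x t →
    η t x = η s x
  ring : ∀ (x : ℤ) (t : ℝ≥0), RingsAt (n x) t →
    ∀ᶠ s in 𝓝[<] t, η t x = tasepUpdate x (η s) x ∧ η t (x + 1) = tasepUpdate x (η s) (x + 1)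

/-- `η` is the multi-type TASEP on `ℤ` started from `η_0(x) = -x` (graphical construction):
a stochastic process whose paths are almost surely driven by the independent rate `1`
exponential clocks `N`. -/
structure IsMultiTypeTasep {Ω : Type*} [MeasurableSpace Ω] (N : ℤ → ℝ≥0 → Ω → ℕ)
    (η : ℝ≥0 → Ω → ℤ → ℤ) (P : Measure Ω) : Prop where
  clocks : IsClockFamily N P
  measurable : ∀ t x, Measurable fun ω => η t ω x
  path : ∀ᵐ ω ∂P, IsTasepPath (fun x t => N x t ω) (fun t => η t ω)

/-- In configuration `η`, the particle of type `i` is a `k`-leader: `i ≥ k`, and the position of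
the particle of type `i` is at least the position of every particle of type `z ≥ k`. -/
def IsLeader (η : ℤ → ℤ) (k i : ℤ) : Prop :=
  k ≤ i ∧ ∃ x, η x = i ∧ ∀ z ≥ k, ∀ y, η y = z → y ≤ x

/-! The rightmost particle of type at least `k` has only types below `k` to its right, so it moves
one step right whenever the clock at its position rings, and no other ring changes where the
rightmost such particle sits. Hence the leader positions for `k₁` and `k₂` are rate one walks from
`-k₁` and `-k₂` driven by the same clocks: independent while apart, together for ever once they
meet. The `k₁`-leader has type at least `k₂` exactly when the two positions agree
(`exists_isLeader_iff`), so the probability sought is that of meeting by time `t` from distance `k₂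
- k₁`.

That meeting probability solves the discrete heat equation in the distance, with value 1 at distance
0 and initial value 0 at positive distances. The contour integral has these properties: the exponent
is the eigenvalue of the Laplacian on powers of `1 + w` (`contourIntegrand_laplacian`), the factor
`(w + 2) / w` kills the Laplacian at 0 (`discreteLaplacian_meetingProb_zero`), and residues give the
initial data.

Time is cut into cells of length `h`. On a fine grid the leaders follow the discrete `walk`
(`IsTasepPath.isLastSite_walk`), while the contour integral is a martingale along a pair of walks up
to an error of order `h ^ 2` per cell (`IsClockFamily.norm_integral_meetingProb_walk_sub_le`).
Refining the grid gives the identity. -/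

/-! ### Grid walks and the motion of a leader along a single path. -/

/-- One step of a walker at `a` which moves to the right if its clock has rung, where `v x` is the
number of rings of clock `x`. -/
def walkStep (v : ℤ → ℕ) (a : ℤ) : ℤ := if v a = 0 then a else a + 1

/-- The walk started from `a` when `v j x` is the number of rings of clock `x` in the `j`-th time
interval. -/
def walk (v : ℕ → ℤ → ℕ) (a : ℤ) : ℕ → ℤ
  | 0 => a
  | j + 1 => walkStep (v j) (walk v a j)

/-- Among the sites up to `B`, the rightmost one whose particle has type at least `k` is `x`. -/
def IsLastSite (η : ℤ → ℤ) (k B x : ℤ) : Prop :=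
  k ≤ η x ∧ x ≤ B ∧ ∀ y, x < y → y ≤ B → η y < k

/-- The clocks in `[A, B]` ring at most once in total during `(s, u]`. -/
def AtMostOneRing (n : ℤ → ℝ≥0 → ℕ) (A B : ℤ) (s u : ℝ≥0) : Prop :=
  (∀ c ∈ Finset.Icc A B, n c u - n c s < 2) ∧
    ∀ c ∈ Finset.Icc A B, ∀ c' ∈ Finset.Icc A B, c ≠ c' → n c u - n c s = 0 ∨ n c' u - n c' s = 0

theorem le_walkStep (v : ℤ → ℕ) (a : ℤ) : a ≤ walkStep v a := by
  unfold walkStep; split_ifs <;> omega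

theorem walkStep_mono (v : ℤ → ℕ) {a b : ℤ} (h : b ≤ a) : walkStep v b ≤ walkStep v a := by
  rcases h.eq_or_lt with rfl | h
  · exact le_rfl
  · unfold walkStep; split_ifs <;> omega

theorem le_walk (v : ℕ → ℤ → ℕ) (a : ℤ) (j : ℕ) : a ≤ walk v a j := by
  induction j with
  | zero => exact le_rfl
  | succ j ih => exact ih.trans (le_walkStep _ _)

theorem walk_mono (v : ℕ → ℤ → ℕ) {a b : ℤ} (h : b ≤ a) (j : ℕ) : walk v b j ≤ walk v a j := by
  induction j with
  | zero => exact h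
  | succ j ih => exact walkStep_mono _ ih

theorem IsLastSite.unique {η : ℤ → ℤ} {k B x y : ℤ} (hx : IsLastSite η k B x)
    (hy : IsLastSite η k B y) : x = y := by
  rcases lt_trichotomy x y with h | h | h
  · exact absurd (hx.2.2 y h hy.2.1) (not_lt.2 hy.1)
  · exact h
  · exact absurd (hy.2.2 x h hx.2.1) (not_lt.2 hx.1)

theorem tasepUpdate_left (x : ℤ) (η : ℤ → ℤ) : tasepUpdate x η x = min (η x) (η (x + 1)) := by
  unfold tasepUpdate
  split_ifs with h
  · simp [min_eq_right h.le]
  · simp [min_eq_left (not_lt.1 h)]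

theorem tasepUpdate_right (x : ℤ) (η : ℤ → ℤ) :
    tasepUpdate x η (x + 1) = max (η x) (η (x + 1)) := by
  unfold tasepUpdate
  split_ifs with h
  · simp [max_eq_left h.le]
  · simp [max_eq_right (not_lt.1 h)]

/-- The ring time is the infimum of the times at which the path has reached its final value; right
continuity makes the infimum attained. -/
theorem exists_ringsAt {n : ℝ≥0 → ℕ} (hmono : Monotone n)
    (hrc : ∀ t, ContinuousWithinAt n (Set.Ici t) t) {s u : ℝ≥0}
    (h : n u = n s + 1) :
    ∃ r, s < r ∧ r ≤ u ∧ RingsAt n r ∧ n r = n u ∧ ∀ v, s ≤ v → v < r → n v = n s := by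
  set S : Set ℝ≥0 := {v | n u ≤ n v} with hS
  have huS : u ∈ S := le_refl (n u)
  set r := sInf S with hr
  have hru : r ≤ u := csInf_le (OrderBot.bddBelow S) huS
  have hlt : ∀ v, v < r → n v < n u := fun v hv => by
    by_contra hc
    exact absurd (csInf_le (OrderBot.bddBelow S) (not_lt.1 hc)) (not_le.2 hv)
  have hrS : n u ≤ n r := by
    have h1 : {v | n v = n r} ∈ 𝓝[Set.Ici r] r :=
      (hrc r) (show {n r} ∈ 𝓝 (n r) from by simp)
    obtain ⟨e, he, hsub⟩ := (mem_nhdsGE_iff_exists_Ico_subset' (show r < r + 1 by simp)).1 h1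
    obtain ⟨v, hvS, hve⟩ := exists_lt_of_csInf_lt ⟨u, huS⟩ (show sInf S < e from he)
    have hv : n v = n r := hsub ⟨csInf_le (OrderBot.bddBelow S) hvS, hve⟩
    exact hv ▸ hvS
  have hru' : n r = n u := le_antisymm (hmono hru) hrS
  have hsr : s < r := by
    by_contra hc
    have := hmono (not_lt.1 hc)
    omega
  refine ⟨r, hsr, hru, ⟨(zero_le : (0 : ℝ≥0) ≤ s).trans_lt hsr, fun v hv => hru' ▸ hlt v hv⟩, hru', ?_⟩
  intro v hsv hv
  have := hlt v hv
  have := hmono hsv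
  omega

section Path

variable {n : ℤ → ℝ≥0 → ℕ} {η : ℝ≥0 → ℤ → ℤ}

/-- A ring at `X` swaps, since the right neighbour has type below `k`; a ring at `X - 1` leaves the
larger type at `X`; a ring further right only permutes types below `k`. The silent clock at `B`
isolates the window from the right. On the left, clock `A - 1` is watched because it touches site
`A`, but nothing about site `A - 1` is needed. -/
theorem IsTasepPath.isLastSite_walkStep (hη : IsTasepPath n η) (hmono : ∀ x, Monotone (n x))
    (hrc : ∀ x t, ContinuousWithinAt (n x) (Set.Ici t) t) {A B k X : ℤ} {s u : ℝ≥0} (hsu : s ≤ u)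
    (hring : AtMostOneRing n (A - 1) B s u) (hB : n B u = n B s) (hAX : A ≤ X)
    (hX : IsLastSite (η s) k B X) :
    IsLastSite (η u) k B (walkStep (fun c => n c u - n c s) X) := by
  obtain ⟨h1, h2⟩ := hring
  obtain ⟨hkX, hXB, hlast⟩ := hX
  by_cases hall : ∀ c ∈ Finset.Icc (A - 1) B, n c u = n c s
  · have hstay : ∀ y, A ≤ y → y ≤ B → η u y = η s y := fun y hy hyB =>
      hη.stay y s u hsu (hall _ (by simp; omega)).symm (hall _ (by simp; omega)).symm
    have hw : walkStep (fun c => n c u - n c s) X = X := by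
      simp [walkStep, hall X (by simp; omega)]
    rw [hw]
    refine ⟨by rwa [hstay X hAX hXB], hXB, fun y hy hyB => ?_⟩
    rw [hstay y (by omega) hyB]
    exact hlast y hy hyB
  · push Not at hall
    obtain ⟨c, hc, hne⟩ := hall
    have hcu : n c u = n c s + 1 := by
      have := h1 c hc
      have := hmono c hsu
      omega
    have hother : ∀ d ∈ Finset.Icc (A - 1) B, d ≠ c → n d u = n d s := fun d hd hdc => by
      have := h2 c hc d hd hdc.symm
      have := hmono d hsu
      omega
    -- Thus `c + 1` still lies in the window, so both swapped sites are under control.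
    have hcB : c ≠ B := fun h => hne (h ▸ hB)
    obtain ⟨r, hsr, hru, hr, hnr, hbefore⟩ := exists_ringsAt (hmono c) (hrc c) hcu
    have hmid : ∀ d ∈ Finset.Icc (A - 1) B, d ≠ c → ∀ v, s ≤ v → v ≤ u → n d v = n d s :=
      fun d hd hdc v hsv hvu => le_antisymm (hother d hd hdc ▸ hmono d hvu) (hmono d hsv)
    have : (𝓝[<] r).NeBot := nhdsLT_neBot_of_exists_lt ⟨s, hsr⟩
    -- A time just before the ring but after `s`: the window still looks as it did at `s`.
    obtain ⟨v, ⟨hvl, hvr⟩, hsv, hv⟩ := ((hη.ring c r hr).and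
      (Ioo_mem_nhdsLT hsr : Set.Ioo s r ∈ 𝓝[<] r)).exists
    rw [tasepUpdate_left] at hvl
    rw [tasepUpdate_right] at hvr
    have hpre : ∀ y, A ≤ y → y ≤ B → η v y = η s y := by
      have : ∀ d ∈ Finset.Icc (A - 1) B, n d s = n d v := fun d hd => by
        by_cases hdc : d = c
        · rw [hdc, hbefore v hsv.le hv]
        · rw [hmid d hd hdc v hsv.le (hv.le.trans hru)]
      exact fun y hy hyB => hη.stay y s v hsv.le (this _ (by simp; omega)) (this _ (by simp; omega))
    have hpost : ∀ y, A ≤ y → y ≤ B → η u y = η r y := by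
      have : ∀ d ∈ Finset.Icc (A - 1) B, n d r = n d u := fun d hd => by
        by_cases hdc : d = c
        · rw [hdc, hnr]
        · rw [hmid d hd hdc r hsr.le hru, hother d hd hdc]
      exact fun y hy hyB => hη.stay y r u hru (this _ (by simp; omega)) (this _ (by simp; omega))
    have hstay : ∀ y, A ≤ y → y ≤ B → y ≠ c → y ≠ c + 1 → η u y = η s y := fun y hy hyB h3 h4 =>
      hη.stay y s u hsu (hother _ (by simp; omega) (by omega)).symm
        (hother _ (by simp; omega) h3).symm
    simp only [Finset.mem_Icc] at hc
    rcases eq_or_ne c X with rfl | hcX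
    · have hw : walkStep (fun d => n d u - n d s) c = c + 1 := by simp [walkStep, hcu]
      rw [hw]
      refine ⟨?_, by omega, fun y hy hyB => ?_⟩
      · rw [hpost _ (by omega) (by omega), hvr, hpre c hAX hXB]
        exact hkX.trans (le_max_left _ _)
      · rw [hstay y (by omega) hyB (by omega) (by omega)]
        exact hlast y (by omega) hyB
    · have hw : walkStep (fun d => n d u - n d s) X = X := by
        simp [walkStep, hother X (by simp; omega) hcX.symm]
      rw [hw]
      refine ⟨?_, hXB, fun y hy hyB => ?_⟩
      · rcases eq_or_ne X (c + 1) with h | h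
        · rw [hpost X hAX hXB, h, hvr, ← h, hpre X hAX hXB]
          exact hkX.trans (le_max_right _ _)
        · rwa [hstay X hAX hXB hcX.symm h]
      · rcases eq_or_ne y c with rfl | h3
        · rw [hpost y (by omega) hyB, hvl, hpre y (by omega) hyB]
          exact (min_le_left _ _).trans_lt (hlast y hy hyB)
        · rcases eq_or_ne y (c + 1) with rfl | h4
          · rw [hpost _ (by omega) hyB, hvr, hpre _ (by omega) hyB, hpre c (by omega) (by omega)]
            exact max_lt (hlast c (by omega) (by omega)) (hlast _ hy hyB)
          · rw [hstay y (by omega) hyB h3 h4]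
            exact hlast y hy hyB

theorem IsTasepPath.isLastSite_walk (hη : IsTasepPath n η) (hmono : ∀ x, Monotone (n x))
    (hrc : ∀ x t, ContinuousWithinAt (n x) (Set.Ici t) t) {B k : ℤ} {h : ℝ≥0} {m : ℕ}
    (hkB : -k ≤ B) (hB : n B (m * h) = n B 0)
    (hring : ∀ j < m, AtMostOneRing n (-k - 1) B (j * h) ((j + 1 : ℕ) * h)) :
    IsLastSite (η (m * h)) k B
      (walk (fun j c => n c ((j + 1 : ℕ) * h) - n c (j * h)) (-k) m) := by
  have key : ∀ j ≤ m, IsLastSite (η (j * h)) k B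
      (walk (fun j c => n c ((j + 1 : ℕ) * h) - n c (j * h)) (-k) j) := by
    have hconst : ∀ j ≤ m, n B (j * h) = n B 0 := fun j hj =>
      le_antisymm (hB ▸ hmono B (by gcongr)) (hmono B zero_le)
    intro j
    induction j with
    | zero =>
      intro _
      simp only [CharP.cast_eq_zero, zero_mul, walk]
      refine ⟨by simp [hη.init], hkB, fun y hy _ => ?_⟩
      rw [hη.init]; omega
    | succ j ih =>
      intro hj
      exact hη.isLastSite_walkStep hmono hrc (by gcongr; simp) (hring j hj)
        (by rw [hconst _ hj, hconst j (by omega)]) (le_walk _ _ _) (ih (by omega))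
  exact key m le_rfl

end Path

/-! ### The contour integral: heat equation, boundary value and initial value. -/

/-- The integrand of the contour integral, for time `s` and initial distance `d`. -/
noncomputable def contourIntegrand (s : ℝ) (d : ℤ) (w : ℂ) : ℂ :=
  (w + 2) / w * (1 + w) ^ (-d - 1) * Complex.exp (s * w ^ 2 / (1 + w))

/-- The probability that two independent rate one Poisson walks started at distance `d ≥ 0` have
met by time `s`, as a contour integral. -/
noncomputable def meetingProb (s : ℝ) (d : ℤ) : ℂ :=
  (2 * (Real.pi : ℂ) * Complex.I)⁻¹ • ∮ w in C(0, 3), contourIntegrand s d w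

/-- The discrete Laplacian on `ℤ`. -/
def discreteLaplacian (g : ℤ → ℂ) (d : ℤ) : ℂ := g (d + 1) + g (d - 1) - 2 * g d

theorem ne_zero_of_one_lt_norm {w : ℂ} (hw : 1 < ‖w‖) : w ≠ 0 ∧ 1 + w ≠ 0 := by
  constructor
  · rintro rfl; simp at hw; linarith
  · intro h
    rw [show w = -1 by linear_combination h] at hw
    simp at hw

theorem differentiableAt_contourIntegrand (s : ℝ) (d : ℤ) {w : ℂ} (hw : 1 < ‖w‖) :
    DifferentiableAt ℂ (contourIntegrand s d) w := by
  obtain ⟨h0, h1⟩ := ne_zero_of_one_lt_norm hw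
  unfold contourIntegrand
  have hz : DifferentiableAt ℂ (fun w : ℂ => (1 + w) ^ (-d - 1)) w :=
    DifferentiableAt.zpow (by fun_prop) (Or.inl h1)
  have he : DifferentiableAt ℂ (fun w : ℂ => (s : ℂ) * w ^ 2 / (1 + w)) w :=
    DifferentiableAt.div (by fun_prop) (by fun_prop) h1
  exact ((DifferentiableAt.div (by fun_prop) (by fun_prop) h0).mul hz).mul he.cexp

theorem circleIntegral_contourIntegrand_eq (s : ℝ) (d : ℤ) {r R : ℝ} (hr : 1 < r) (hR : r ≤ R) :
    (∮ w in C(0, R), contourIntegrand s d w) = ∮ w in C(0, r), contourIntegrand s d w := by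
  refine Complex.circleIntegral_eq_of_differentiable_on_annulus_off_countable (by linarith) hR
    Set.countable_empty (fun w hw => ?_) (fun w hw => ?_)
  · simp only [Set.mem_sdiff, Metric.mem_closedBall, Metric.mem_ball, dist_zero_right, not_lt] at hw
    exact (differentiableAt_contourIntegrand s d (by linarith)).continuousAt.continuousWithinAt
  · simp only [Set.mem_sdiff, Metric.mem_closedBall, Metric.mem_ball, dist_zero_right, not_le] at hw
    exact differentiableAt_contourIntegrand s d (by linarith [hw.1.2])

/-- The only singularities, 0 and -1, lie in the closed unit disc. Radius 3 is a convenient choice: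
there `‖1 + w‖ ≥ 2`, which gives the uniform bounds below. -/
theorem circleIntegral_contourIntegrand (s : ℝ) (d : ℤ) {R : ℝ} (hR : 1 < R) :
    (∮ w in C(0, R), contourIntegrand s d w) = ∮ w in C(0, 3), contourIntegrand s d w := by
  rcases le_total R 3 with h | h
  · exact (circleIntegral_contourIntegrand_eq s d hR h).symm
  · exact circleIntegral_contourIntegrand_eq s d (by norm_num) h

theorem circleIntegrable_contourIntegrand (s : ℝ) (d : ℤ) :
    CircleIntegrable (contourIntegrand s d) 0 3 := by
  refine ContinuousOn.circleIntegrable (by norm_num) fun w hw => ?_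
  rw [mem_sphere_zero_iff_norm] at hw
  exact (differentiableAt_contourIntegrand s d (by rw [hw]; norm_num)).continuousAt.continuousWithinAt

/-- This is `(1 + w)⁻¹ + (1 + w) - 2 = w ^ 2 / (1 + w)`, the very rate in the exponential. -/
theorem contourIntegrand_laplacian (s : ℝ) (d : ℤ) {w : ℂ} (hw : 1 < ‖w‖) :
    contourIntegrand s (d + 1) w + contourIntegrand s (d - 1) w - 2 * contourIntegrand s d w =
      w ^ 2 / (1 + w) * contourIntegrand s d w := by
  obtain ⟨h0, h1⟩ := ne_zero_of_one_lt_norm hw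
  unfold contourIntegrand
  have e1 : (1 + w) ^ (-d - 1) = (1 + w) ^ (-(d + 1) - 1) * (1 + w) := by
    rw [← zpow_add_one₀ h1]; congr 1; ring
  have e2 : (1 + w) ^ (-(d - 1) - 1) = (1 + w) ^ (-(d + 1) - 1) * (1 + w) * (1 + w) := by
    rw [← zpow_add_one₀ h1, ← zpow_add_one₀ h1]; congr 1; ring
  rw [e1, e2]
  field_simp
  ring

theorem contourIntegrand_add (s h : ℝ) (d : ℤ) (w : ℂ) :
    contourIntegrand (s + h) d w =
      Complex.exp (h * (w ^ 2 / (1 + w))) * contourIntegrand s d w := by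
  unfold contourIntegrand
  rw [show ((s + h : ℝ) : ℂ) * w ^ 2 / (1 + w) = h * (w ^ 2 / (1 + w)) + s * w ^ 2 / (1 + w) by
    push_cast; ring, Complex.exp_add]
  ring

theorem discreteLaplacian_meetingProb (s : ℝ) (d : ℤ) :
    discreteLaplacian (meetingProb s) d = (2 * (Real.pi : ℂ) * Complex.I)⁻¹ •
      ∮ w in C(0, 3), w ^ 2 / (1 + w) * contourIntegrand s d w := by
  have hi := circleIntegrable_contourIntegrand s
  have : (∮ w in C(0, 3), w ^ 2 / (1 + w) * contourIntegrand s d w) =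
      ∮ w in C(0, 3), (contourIntegrand s (d + 1) w + contourIntegrand s (d - 1) w -
        2 * contourIntegrand s d w) := by
    refine circleIntegral.integral_congr (by norm_num) fun w hw => ?_
    rw [mem_sphere_zero_iff_norm] at hw
    exact (contourIntegrand_laplacian s d (by rw [hw]; norm_num)).symm
  have h2 : CircleIntegrable (fun w => 2 * contourIntegrand s d w) 0 3 :=
    IntervalIntegrable.const_mul (hi d) 2
  have hadd : CircleIntegrable
      (fun w => contourIntegrand s (d + 1) w + contourIntegrand s (d - 1) w) 0 3 :=
    (hi _).add (hi _)
  rw [this, circleIntegral.integral_sub hadd h2,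
    circleIntegral.integral_add (hi _) (hi _), circleIntegral.integral_const_mul]
  simp only [discreteLaplacian, meetingProb, smul_eq_mul]
  ring

theorem norm_sq_div_one_add_le {w : ℂ} (hw : ‖w‖ = 3) : ‖w ^ 2 / (1 + w)‖ ≤ 5 := by
  have h2 : 2 ≤ ‖1 + w‖ := by
    have := norm_sub_norm_le w (-1)
    rw [sub_neg_eq_add, norm_neg, norm_one, hw, add_comm w] at this
    linarith
  rw [norm_div, norm_pow, hw, div_le_iff₀ (by linarith)]
  linarith

theorem norm_contourIntegrand_le {s t : ℝ} (hs : 0 ≤ s) (hst : s ≤ t) {d : ℤ} (hd : 0 ≤ d) {w : ℂ}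
    (hw : ‖w‖ = 3) : ‖contourIntegrand s d w‖ ≤ 2 * Real.exp (5 * t) := by
  have h2 : 1 ≤ ‖1 + w‖ := by
    have := norm_sub_norm_le w (-1)
    rw [sub_neg_eq_add, norm_neg, norm_one, hw, add_comm w] at this
    linarith
  have h3 : ‖(w + 2) / w‖ ≤ 2 := by
    rw [norm_div, hw, div_le_iff₀ (by norm_num)]
    calc ‖w + 2‖ ≤ ‖w‖ + ‖(2 : ℂ)‖ := norm_add_le _ _
      _ ≤ 2 * 3 := by rw [hw]; norm_num
  have h4 : ‖(1 + w) ^ (-d - 1)‖ ≤ 1 := by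
    rw [norm_zpow]
    exact zpow_le_one_of_nonpos₀ h2 (by omega)
  have h5 : ‖Complex.exp (s * w ^ 2 / (1 + w))‖ ≤ Real.exp (5 * t) := by
    refine (Complex.norm_exp_le_exp_norm _).trans (Real.exp_le_exp.2 ?_)
    rw [mul_div_assoc, norm_mul, Complex.norm_real, Real.norm_of_nonneg hs, mul_comm]
    exact mul_le_mul (norm_sq_div_one_add_le hw) hst hs (by norm_num)
  unfold contourIntegrand
  rw [norm_mul, norm_mul]
  calc _ ≤ 2 * 1 * Real.exp (5 * t) := by gcongr
    _ = _ := by ring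

theorem norm_meetingProb_le {s t : ℝ} (hs : 0 ≤ s) (hst : s ≤ t) {d : ℤ} (hd : 0 ≤ d) :
    ‖meetingProb s d‖ ≤ 3 * (2 * Real.exp (5 * t)) :=
  circleIntegral.norm_two_pi_i_inv_smul_integral_le_of_norm_le_const (by norm_num) fun w hw =>
    norm_contourIntegrand_le hs hst hd (mem_sphere_zero_iff_norm.1 hw)

theorem norm_discreteLaplacian_meetingProb_le {s t : ℝ} (hs : 0 ≤ s) (hst : s ≤ t) {d : ℤ}
    (hd : 0 ≤ d) : ‖discreteLaplacian (meetingProb s) d‖ ≤ 3 * (5 * (2 * Real.exp (5 * t))) := by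
  rw [discreteLaplacian_meetingProb]
  refine circleIntegral.norm_two_pi_i_inv_smul_integral_le_of_norm_le_const (by norm_num)
    fun w hw => ?_
  rw [mem_sphere_zero_iff_norm] at hw
  rw [norm_mul]
  exact mul_le_mul (norm_sq_div_one_add_le hw) (norm_contourIntegrand_le hs hst hd hw)
    (norm_nonneg _) (by norm_num)

/-- The heat equation in finite form: second order Taylor expansion of the exponential under the
integral, where the exponent has norm at most `h * 5 ≤ 1`. -/
theorem norm_meetingProb_add_sub_le {s t h : ℝ} (hs : 0 ≤ s) (hst : s ≤ t) (hh : 0 ≤ h)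
    (hh5 : h * 5 ≤ 1) {d : ℤ} (hd : 0 ≤ d) :
    ‖meetingProb (s + h) d - meetingProb s d - h * discreteLaplacian (meetingProb s) d‖ ≤
      3 * ((h * 5) ^ 2 * (2 * Real.exp (5 * t))) := by
  have hi := circleIntegrable_contourIntegrand
  have hi' : CircleIntegrable (fun w => w ^ 2 / (1 + w) * contourIntegrand s d w) 0 3 := by
    refine ContinuousOn.circleIntegrable (by norm_num) fun w hw => ?_
    rw [mem_sphere_zero_iff_norm] at hw
    have hw1 : 1 < ‖w‖ := by rw [hw]; norm_num
    exact ((ContinuousAt.div (by fun_prop) (by fun_prop) (ne_zero_of_one_lt_norm hw1).2).mul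
      (differentiableAt_contourIntegrand s d hw1).continuousAt).continuousWithinAt
  have : meetingProb (s + h) d - meetingProb s d - h * discreteLaplacian (meetingProb s) d =
      (2 * (Real.pi : ℂ) * Complex.I)⁻¹ • ∮ w in C(0, 3),
        (contourIntegrand (s + h) d w - contourIntegrand s d w -
          h * (w ^ 2 / (1 + w) * contourIntegrand s d w)) := by
    have h2 : CircleIntegrable (fun w => h * (w ^ 2 / (1 + w) * contourIntegrand s d w)) 0 3 :=
      IntervalIntegrable.const_mul hi' (h : ℂ)
    have hsub : CircleIntegrable
        (fun w => contourIntegrand (s + h) d w - contourIntegrand s d w) 0 3 :=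
      (hi _ _).sub (hi _ _)
    rw [circleIntegral.integral_sub hsub h2,
      circleIntegral.integral_sub (hi _ _) (hi _ _), circleIntegral.integral_const_mul,
      discreteLaplacian_meetingProb]
    simp only [meetingProb, smul_eq_mul]
    ring
  rw [this]
  refine circleIntegral.norm_two_pi_i_inv_smul_integral_le_of_norm_le_const (by norm_num)
    fun w hw => ?_
  rw [mem_sphere_zero_iff_norm] at hw
  have hn : ‖(h : ℂ) * (w ^ 2 / (1 + w))‖ ≤ h * 5 := by
    rw [norm_mul, Complex.norm_real, Real.norm_of_nonneg hh]
    exact mul_le_mul_of_nonneg_left (norm_sq_div_one_add_le hw) hh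
  rw [contourIntegrand_add, show ∀ E φ F : ℂ, E * F - F - h * (φ * F) = (E - 1 - h * φ) * F by
    intros; ring, norm_mul]
  exact mul_le_mul ((Complex.norm_exp_sub_one_sub_id_le (hn.trans hh5)).trans (by gcongr))
    (norm_contourIntegrand_le hs hst hd hw) (norm_nonneg _) (by positivity)

/-- With `φ = w ^ 2 / (1 + w)`, the factor `(w + 2) / w` turns the integrand into `φ' * exp (s φ)`,
which has the primitive `exp (s φ) / s`, or `φ` when `s = 0`, along the closed contour. This is the
absorbing boundary condition for walkers that have met. -/
theorem discreteLaplacian_meetingProb_zero (s : ℝ) :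
    discreteLaplacian (meetingProb s) 0 = 0 := by
  rw [discreteLaplacian_meetingProb]
  have hφ : ∀ w : ℂ, 1 + w ≠ 0 →
      HasDerivAt (fun w : ℂ => w ^ 2 / (1 + w)) (w * (w + 2) / (1 + w) ^ 2) w := fun w hw => by
    convert! (hasDerivAt_pow 2 w).div ((hasDerivAt_id w).const_add 1) hw using 1
    simp
    ring
  rw [circleIntegral.integral_congr (g := fun w => w * (w + 2) / (1 + w) ^ 2 *
    Complex.exp (s * (w ^ 2 / (1 + w)))) (by norm_num)]
  · rw [circleIntegral.integral_eq_zero_of_hasDerivWithinAt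
      (f := fun w => if s = 0 then w ^ 2 / (1 + w) else
        Complex.exp (s * (w ^ 2 / (1 + w))) / s) (by norm_num), smul_zero]
    intro w hw
    rw [mem_sphere_zero_iff_norm] at hw
    have h1 := (ne_zero_of_one_lt_norm (w := w) (by rw [hw]; norm_num)).2
    by_cases hs : s = 0
    · simpa [hs] using (hφ w h1).hasDerivWithinAt
    · simp only [hs, if_false]
      have hs' : (s : ℂ) ≠ 0 := by exact_mod_cast hs
      have := ((((hφ w h1).const_mul (s : ℂ)).cexp).div_const (s : ℂ)).hasDerivWithinAt
        (s := Metric.sphere 0 3)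
      convert! this using 1
      field_simp
  · intro w hw
    rw [mem_sphere_zero_iff_norm] at hw
    obtain ⟨h0, h1⟩ := ne_zero_of_one_lt_norm (w := w) (by rw [hw]; norm_num)
    simp only [contourIntegrand, neg_zero, zero_sub, zpow_neg_one, mul_div_assoc]
    field_simp

theorem circleIntegral_one_add_zpow {n : ℤ} (hn : n ≠ -1) :
    (∮ w in C(0, 3), (1 + w) ^ n) = (0 : ℂ) := by
  simpa [add_comm] using circleIntegral.integral_sub_zpow_of_ne hn 0 (-1) 3

theorem circleIntegral_one_add_inv :
    (∮ w in C(0, 3), (1 + w)⁻¹) = 2 * (Real.pi : ℂ) * Complex.I := by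
  simpa [add_comm] using circleIntegral.integral_sub_inv_of_mem_ball
    (c := 0) (w := -1) (R := 3) (by simp)

theorem circleIntegrable_one_add_zpow (n : ℤ) :
    CircleIntegrable (fun w : ℂ => (1 + w) ^ n) 0 3 := by
  refine ContinuousOn.circleIntegrable (by norm_num) fun w hw => ?_
  rw [mem_sphere_zero_iff_norm] at hw
  exact (ContinuousAt.zpow₀ (by fun_prop) _
    (Or.inl (ne_zero_of_one_lt_norm (by rw [hw]; norm_num)).2)).continuousWithinAt

/-- Partial fractions leave `2 / w - 1 / (1 + w)`, with residues 2 and -1. -/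
theorem meetingProb_zero_zero : meetingProb 0 0 = 1 := by
  have hpi : (2 * (Real.pi : ℂ) * Complex.I) ≠ 0 := Complex.two_pi_I_ne_zero
  have h0 : CircleIntegrable (fun w : ℂ => 2 * w⁻¹) 0 3 := by
    refine ContinuousOn.circleIntegrable (by norm_num) fun w hw => ?_
    rw [mem_sphere_zero_iff_norm] at hw
    exact (continuousAt_const.mul (continuousAt_inv₀
      (ne_zero_of_one_lt_norm (by rw [hw]; norm_num)).1)).continuousWithinAt
  have h1 := circleIntegrable_one_add_zpow (-1)
  simp only [zpow_neg_one] at h1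
  have hinv : (∮ w in C(0, 3), w⁻¹) = 2 * (Real.pi : ℂ) * Complex.I := by
    simpa using circleIntegral.integral_sub_center_inv 0 (R := 3) (by norm_num)
  unfold meetingProb
  rw [circleIntegral.integral_congr (g := fun w => 2 * w⁻¹ - (1 + w)⁻¹) (by norm_num),
    circleIntegral.integral_sub h0 h1, circleIntegral.integral_const_mul, hinv,
    circleIntegral_one_add_inv, smul_eq_mul]
  · field_simp
    norm_num
  · intro w hw
    rw [mem_sphere_zero_iff_norm] at hw
    obtain ⟨h0, h1⟩ := ne_zero_of_one_lt_norm (w := w) (by rw [hw]; norm_num)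
    simp only [contourIntegrand, neg_zero, zero_sub, zpow_neg_one, Complex.ofReal_zero, zero_mul,
      zero_div, Complex.exp_zero]
    field_simp
    ring

/-- Taking differences in `d` cancels the pole at 0, leaving pure powers of `1 + w`; only the
exponent -1 contributes, so the difference is 1 at `d = 0` and 0 for `d ≥ 1`. -/
theorem meetingProb_zero_sub (d : ℤ) : meetingProb 0 d - meetingProb 0 (d + 1) =
    (2 * (Real.pi : ℂ) * Complex.I)⁻¹ •
      ((∮ w in C(0, 3), (1 + w) ^ (-d - 1)) + ∮ w in C(0, 3), (1 + w) ^ (-d - 2)) := by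
  have hi := circleIntegrable_contourIntegrand 0
  unfold meetingProb
  rw [← smul_sub, ← circleIntegral.integral_sub (hi _) (hi _),
    ← circleIntegral.integral_add (circleIntegrable_one_add_zpow _)
      (circleIntegrable_one_add_zpow _)]
  congr 1
  refine circleIntegral.integral_congr (by norm_num) fun w hw => ?_
  rw [mem_sphere_zero_iff_norm] at hw
  obtain ⟨h0, h1⟩ := ne_zero_of_one_lt_norm (w := w) (by rw [hw]; norm_num)
  have e1 : (1 + w) ^ (-d - 1) = (1 + w) ^ (-d - 2) * (1 + w) := by
    rw [← zpow_add_one₀ h1]; congr 1; ring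
  have e2 : -(d + 1) - 1 = -d - 2 := by ring
  simp only [contourIntegrand, Complex.ofReal_zero, zero_mul, zero_div, Complex.exp_zero]
  rw [e2, e1]
  field_simp
  ring

theorem meetingProb_zero_of_pos {d : ℤ} (hd : 0 < d) : meetingProb 0 d = 0 := by
  induction d, (show (1 : ℤ) ≤ d from hd) using Int.leInduction with
  | base =>
    have h := meetingProb_zero_sub 0
    rw [circleIntegral_one_add_zpow (show (-0 - 2 : ℤ) ≠ -1 by norm_num), meetingProb_zero_zero]
      at h
    simp only [neg_zero, zero_sub, zpow_neg_one, circleIntegral_one_add_inv, add_zero, smul_eq_mul,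
      inv_mul_cancel₀ Complex.two_pi_I_ne_zero, zero_add] at h
    linear_combination -h
  | succ d hd' ih =>
    have h := meetingProb_zero_sub d
    rw [circleIntegral_one_add_zpow (by omega), circleIntegral_one_add_zpow (by omega),
      ih (by omega)] at h
    simpa using h

/-! ### Law of the ring counts and one step of a pair of walks. -/

/-- The number of rings of clock `x` during `(j h, (j + 1) h]`. -/
def ringCount {Ω : Type*} (N : ℤ → ℝ≥0 → Ω → ℕ) (h : ℝ≥0) (ω : Ω) (j : ℕ) (x : ℤ) : ℕ :=
  N x ((j + 1 : ℕ) * h) ω - N x (j * h) ω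

theorem measurable_walkStep (a : ℤ) : Measurable fun v : ℤ → ℕ => walkStep v a :=
  Measurable.ite ((measurable_pi_apply a) (measurableSet_singleton 0)) measurable_const
    measurable_const

theorem measurable_walkStep_prod :
    Measurable fun p : ℤ × (ℤ → ℕ) => walkStep p.2 p.1 :=
  measurable_from_prod_countable_right measurable_walkStep

theorem measurable_walk {Ω : Type*} [MeasurableSpace Ω] {v : Ω → ℕ → ℤ → ℕ} (a : ℤ) {j : ℕ}
    (hv : ∀ i < j, ∀ x, Measurable fun ω => v ω i x) : Measurable fun ω => walk (v ω) a j := by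
  induction j with
  | zero => exact measurable_const
  | succ j ih =>
    exact measurable_walkStep_prod.comp ((ih fun i hi => hv i (by omega)).prodMk
      (measurable_pi_lambda _ (hv j (by omega))))

section Clocks

variable {Ω : Type*} [MeasurableSpace Ω] {P : Measure Ω} {N : ℤ → ℝ≥0 → Ω → ℕ}

theorem IsClockFamily.measurable_ringCount (hN : IsClockFamily N P) (h : ℝ≥0) (j : ℕ) (x : ℤ) :
    Measurable fun ω => ringCount N h ω j x :=
  ((hN.clock x).measurable _).sub ((hN.clock x).measurable _)

theorem IsClockFamily.iIndepFun_ringCount (hN : IsClockFamily N P) (h : ℝ≥0) :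
    iIndepFun (fun (p : ℤ × ℕ) ω => ringCount N h ω p.2 p.1) P := by
  refine iIndepFun_uncurry' (X := fun x j ω => ringCount N h ω j x)
    (fun x j => hN.measurable_ringCount h j x) ?_ fun x => ?_
  · exact hN.indep.comp (fun _ f j => f ((j + 1 : ℕ) * h) - f (j * h)) fun _ =>
      measurable_pi_lambda _ fun j => (measurable_pi_apply _).sub (measurable_pi_apply _)
  · exact (hN.clock x).indepIncrements.nat (t := fun j : ℕ => (j : ℝ≥0) * h)
      fun i j hij => by dsimp only; gcongr

theorem IsClockFamily.map_ringCount (hN : IsClockFamily N P) (h : ℝ≥0) (j : ℕ) (x : ℤ) :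
    P.map (fun ω => ringCount N h ω j x) = poissonMeasure h := by
  have := (hN.clock x).law (j * h) ((j + 1 : ℕ) * h) (by gcongr; simp)
  rwa [← tsub_mul, show ((j + 1 : ℕ) : ℝ≥0) - j = 1 by push_cast; simp, one_mul] at this

/-- The walks after `j` steps are functions of the counts in cells before `j`. -/
theorem IsClockFamily.indepFun_walk_ringCount (hN : IsClockFamily N P) (h : ℝ≥0) (a b : ℤ)
    (j : ℕ) :
    IndepFun (fun ω => (walk (ringCount N h ω) a j, walk (ringCount N h ω) b j))
      (fun ω => ringCount N h ω j) P := by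
  have hind := indep_iSup_of_disjoint
    (fun p : ℤ × ℕ => (hN.measurable_ringCount h p.2 p.1).comap_le)
    (hN.iIndepFun_ringCount h).iIndep
    (S := {p | p.2 < j}) (T := {p | p.2 = j})
    (Set.disjoint_left.2 fun p (h1 : p.2 < j) (h2 : p.2 = j) => by omega)
  rw [IndepFun_iff_Indep]
  refine indep_of_indep_of_le_left (indep_of_indep_of_le_right hind ?_) ?_
  · refine Measurable.comap_le (@measurable_pi_lambda _ _ _ (_) _ _ fun x => ?_)
    exact Measurable.of_comap_le (le_iSup₂_of_le (x, j) rfl le_rfl)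
  · have hm : ∀ i < j, ∀ x, Measurable[⨆ p ∈ {p : ℤ × ℕ | p.2 < j},
        MeasurableSpace.comap (fun ω => ringCount N h ω p.2 p.1) inferInstance]
        fun ω => ringCount N h ω i x := fun i hi x =>
      Measurable.of_comap_le (le_iSup₂_of_le (x, i) hi le_rfl)
    exact Measurable.comap_le (@Measurable.prodMk _ _ _ _ _ (_) _ _
      (@measurable_walk _ (_) _ a j hm) (@measurable_walk _ (_) _ b j hm))

theorem IsClockFamily.measurable_walk_ringCount (hN : IsClockFamily N P) (h : ℝ≥0) (a : ℤ)
    (j : ℕ) : Measurable fun ω => walk (ringCount N h ω) a j :=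
  measurable_walk a fun i _ x => hN.measurable_ringCount h i x

theorem IsClockFamily.real_inter_ringCount (hN : IsClockFamily N P) (h : ℝ≥0) (j : ℕ) {x y : ℤ}
    (hxy : x ≠ y) (s u : Set ℕ) :
    P.real ({ω | ringCount N h ω j x ∈ s} ∩ {ω | ringCount N h ω j y ∈ u}) =
      P.real {ω | ringCount N h ω j x ∈ s} * P.real {ω | ringCount N h ω j y ∈ u} := by
  have hi : IndepFun (fun ω => ringCount N h ω j x) (fun ω => ringCount N h ω j y) P :=
    (hN.iIndepFun_ringCount h).indepFun (i := (x, j)) (j := (y, j)) (by simp [hxy])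
  have := hi.measure_inter_preimage_eq_mul s u (.of_discrete) (.of_discrete)
  simp only [Measure.real, ← ENNReal.toReal_mul]
  exact congrArg ENNReal.toReal this

theorem IsClockFamily.real_ringCount_eq_zero (hN : IsClockFamily N P) (h : ℝ≥0) (j : ℕ) (x : ℤ) :
    P.real {ω | ringCount N h ω j x = 0} = Real.exp (-h) := by
  have := poissonMeasure_real_singleton h 0
  rw [← hN.map_ringCount h j x,
    map_measureReal_apply (hN.measurable_ringCount h j x) (measurableSet_singleton 0)] at this
  rw [pow_zero, mul_one, Nat.factorial_zero, Nat.cast_one, div_one] at this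
  exact this

variable [IsProbabilityMeasure P]

theorem IsClockFamily.real_ringCount_ne_zero (hN : IsClockFamily N P) (h : ℝ≥0) (j : ℕ) (x : ℤ) :
    P.real {ω | ringCount N h ω j x ≠ 0} = 1 - Real.exp (-h) := by
  rw [← hN.real_ringCount_eq_zero h j x]
  exact probReal_compl_eq_one_sub (hN.measurable_ringCount h j x (measurableSet_singleton 0))

/-- At distinct sites the clocks are independent, so the distance goes up or down by one with
probability `(1 - exp (-h)) * exp (-h)` each. At a common site the same clock moves both walkers;
the formula survives because the Laplacian of `g` vanishes at 0. -/
theorem IsClockFamily.integral_walkStep_sub (hN : IsClockFamily N P) (h : ℝ≥0) (j : ℕ) {a b : ℤ}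
    (hba : b ≤ a) {g : ℤ → ℂ} (hg : discreteLaplacian g 0 = 0) :
    ∫ ω, g (walkStep (ringCount N h ω j) a - walkStep (ringCount N h ω j) b) ∂P =
      g (a - b) + ((1 - Real.exp (-h)) * Real.exp (-h) : ℝ) * discreteLaplacian g (a - b) := by
  rcases hba.eq_or_lt with rfl | hlt
  · simp [hg]
  set S := {ω | ringCount N h ω j a ∈ ({0}ᶜ : Set ℕ)} ∩ {ω | ringCount N h ω j b ∈ ({0} : Set ℕ)}
  set T := {ω | ringCount N h ω j a ∈ ({0} : Set ℕ)} ∩ {ω | ringCount N h ω j b ∈ ({0}ᶜ : Set ℕ)}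
  have hms : ∀ x (s : Set ℕ), MeasurableSet {ω | ringCount N h ω j x ∈ s} := fun x s =>
    hN.measurable_ringCount h j x (.of_discrete (s := s))
  have hS : MeasurableSet S := (hms _ _).inter (hms _ _)
  have hT : MeasurableSet T := (hms _ _).inter (hms _ _)
  have hPS : P.real S = (1 - Real.exp (-h)) * Real.exp (-h) := by
    rw [hN.real_inter_ringCount h j hlt.ne']
    exact congrArg₂ _ (hN.real_ringCount_ne_zero h j a) (hN.real_ringCount_eq_zero h j b)
  have hPT : P.real T = (1 - Real.exp (-h)) * Real.exp (-h) := by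
    rw [hN.real_inter_ringCount h j hlt.ne', mul_comm]
    exact congrArg₂ _ (hN.real_ringCount_ne_zero h j b) (hN.real_ringCount_eq_zero h j a)
  have hpt : ∀ ω, g (walkStep (ringCount N h ω j) a - walkStep (ringCount N h ω j) b) =
      g (a - b) + (S.indicator (fun _ => g (a - b + 1) - g (a - b)) ω +
        T.indicator (fun _ => g (a - b - 1) - g (a - b)) ω) := fun ω => by
    by_cases ha : ringCount N h ω j a = 0 <;> by_cases hb : ringCount N h ω j b = 0
    · simp [walkStep, S, T, ha, hb]
    · simp only [walkStep, S, T, ha, hb, Set.indicator, Set.mem_inter_iff, Set.mem_ofPred_eq,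
        Set.mem_compl_iff, Set.mem_singleton_iff]
      simp [show a - (b + 1) = a - b - 1 by ring]
    · simp only [walkStep, S, T, ha, hb, Set.indicator, Set.mem_inter_iff, Set.mem_ofPred_eq,
        Set.mem_compl_iff, Set.mem_singleton_iff]
      simp [show a + 1 - b = a - b + 1 by ring]
    · simp [walkStep, S, T, ha, hb]
  simp_rw [hpt]
  have hiS := (integrable_const (μ := P) (g (a - b + 1) - g (a - b))).indicator hS
  have hiT := (integrable_const (μ := P) (g (a - b - 1) - g (a - b))).indicator hT
  have hiST : Integrable (fun ω => S.indicator (fun _ => g (a - b + 1) - g (a - b)) ω +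
      T.indicator (fun _ => g (a - b - 1) - g (a - b)) ω) P := hiS.add hiT
  rw [integral_add (integrable_const _) hiST, integral_add hiS hiT,
    integral_indicator_const _ hS, integral_indicator_const _ hT, hPS, hPT]
  simp only [integral_const, probReal_univ, one_smul, Complex.real_smul, discreteLaplacian]
  ring

theorem IsClockFamily.integrable_comp_walk_sub (hN : IsClockFamily N P) (h : ℝ≥0) {a b : ℤ}
    (hba : b ≤ a) (j : ℕ) {g : ℤ → ℂ} {C : ℝ} (hg : ∀ d, 0 ≤ d → ‖g d‖ ≤ C) :
    Integrable (fun ω => g (walk (ringCount N h ω) a j - walk (ringCount N h ω) b j)) P :=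
  Integrable.of_bound ((Measurable.of_discrete (f := g)).comp
    ((hN.measurable_walk_ringCount h a j).sub
      (hN.measurable_walk_ringCount h b j))).aestronglyMeasurable C
    (.of_forall fun _ => hg _ (sub_nonneg.2 (walk_mono _ hba j)))

/-- By independence and Fubini the present positions can be frozen while the next cell is averaged.
-/
theorem IsClockFamily.integral_walk_succ_sub (hN : IsClockFamily N P) (h : ℝ≥0) {a b : ℤ}
    (hba : b ≤ a) (j : ℕ) {g : ℤ → ℂ} {C : ℝ} (hgC : ∀ d, 0 ≤ d → ‖g d‖ ≤ C)
    (hg : discreteLaplacian g 0 = 0) :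
    ∫ ω, g (walk (ringCount N h ω) a (j + 1) - walk (ringCount N h ω) b (j + 1)) ∂P =
      ∫ ω, (g (walk (ringCount N h ω) a j - walk (ringCount N h ω) b j) +
        ((1 - Real.exp (-h)) * Real.exp (-h) : ℝ) *
          discreteLaplacian g (walk (ringCount N h ω) a j - walk (ringCount N h ω) b j)) ∂P := by
  set U : Ω → ℤ × ℤ := fun ω => (walk (ringCount N h ω) a j, walk (ringCount N h ω) b j)
  set V : Ω → ℤ → ℕ := fun ω => ringCount N h ω j
  have hU : Measurable U :=
    (hN.measurable_walk_ringCount h a j).prodMk (hN.measurable_walk_ringCount h b j)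
  have hV : Measurable V := measurable_pi_lambda _ fun x => hN.measurable_ringCount h j x
  have hstep : ∀ p : ℤ × ℤ, Measurable fun v => g (walkStep v p.1 - walkStep v p.2) := fun p =>
    (Measurable.of_discrete (f := g)).comp ((measurable_walkStep p.1).sub (measurable_walkStep p.2))
  set F : (ℤ × ℤ) × (ℤ → ℕ) → ℂ := fun q => g (walkStep q.2 q.1.1 - walkStep q.2 q.1.2)
  have hF : Measurable F := measurable_from_prod_countable_right hstep
  have hprod := (hN.indepFun_walk_ringCount h a b j).map_prod_eq_prod_map_map
    hU.aemeasurable hV.aemeasurable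
  have hint : Integrable F ((P.map U).prod (P.map V)) := by
    rw [← hprod, integrable_map_measure hF.aestronglyMeasurable (hU.prodMk hV).aemeasurable]
    exact hN.integrable_comp_walk_sub h hba (j + 1) hgC
  calc _ = ∫ ω, F (U ω, V ω) ∂P := rfl
    _ = ∫ q, F q ∂((P.map U).prod (P.map V)) := by
      rw [← hprod, integral_map (hU.prodMk hV).aemeasurable hF.aestronglyMeasurable]
    _ = ∫ p, ∫ v, F (p, v) ∂(P.map V) ∂(P.map U) := integral_prod _ hint
    _ = ∫ p, ∫ ω, F (p, V ω) ∂P ∂(P.map U) := by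
      congr 1 with p
      exact integral_map hV.aemeasurable (hstep p).aestronglyMeasurable
    _ = ∫ ω', ∫ ω, F (U ω', V ω) ∂P ∂P :=
      integral_map hU.aemeasurable (Measurable.of_discrete).aestronglyMeasurable
    _ = _ := by
      congr 1 with ω
      exact hN.integral_walkStep_sub h j (walk_mono _ hba j) hg

end Clocks

/-! ### Error estimates for the meeting probability of the grid walks. -/

theorem abs_sub_one_sub_exp_mul_exp_le {h : ℝ} (hh : 0 ≤ h) :
    |h - (1 - Real.exp (-h)) * Real.exp (-h)| ≤ 2 * h ^ 2 := by
  have h1 := Real.one_sub_le_exp_neg h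
  have h2 : Real.exp (-h) * (1 + h) ≤ 1 := by
    calc Real.exp (-h) * (1 + h) ≤ Real.exp (-h) * Real.exp h := by
          gcongr; rw [add_comm]; exact Real.add_one_le_exp h
      _ = 1 := by rw [← Real.exp_add]; simp
  have h3 : Real.exp (-h) ≤ 1 := Real.exp_le_one_iff.2 (by linarith)
  have h4 := Real.exp_pos (-h)
  rw [abs_le]
  constructor <;> nlinarith

/-- Two errors add up: Taylor remainder in time, `3 * 25 * 2 = 150`, and replacing the jump
probability by `h`, `2 * 3 * 5 * 2 = 60`. -/
theorem norm_meetingProb_step_le {s t h : ℝ} (hs : 0 ≤ s) (hst : s ≤ t) (hh : 0 ≤ h)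
    (hh5 : h * 5 ≤ 1) {d : ℤ} (hd : 0 ≤ d) :
    ‖meetingProb s d + ((1 - Real.exp (-h)) * Real.exp (-h) : ℝ) *
      discreteLaplacian (meetingProb s) d - meetingProb (s + h) d‖ ≤
      210 * Real.exp (5 * t) * h ^ 2 := by
  set q := (1 - Real.exp (-h)) * Real.exp (-h)
  have h1 := norm_meetingProb_add_sub_le hs hst hh hh5 hd
  have h2 : ‖((h - q : ℝ) : ℂ) * discreteLaplacian (meetingProb s) d‖ ≤
      2 * h ^ 2 * (3 * (5 * (2 * Real.exp (5 * t)))) := by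
    rw [norm_mul, Complex.norm_real]
    exact mul_le_mul (abs_sub_one_sub_exp_mul_exp_le hh)
      (norm_discreteLaplacian_meetingProb_le hs hst hd) (norm_nonneg _) (by positivity)
  rw [show meetingProb s d + (q : ℂ) * discreteLaplacian (meetingProb s) d -
      meetingProb (s + h) d = -((meetingProb (s + h) d - meetingProb s d -
        h * discreteLaplacian (meetingProb s) d) +
        ((h - q : ℝ) : ℂ) * discreteLaplacian (meetingProb s) d) by push_cast; ring, norm_neg]
  refine (norm_add_le _ _).trans ((add_le_add h1 h2).trans_eq ?_)
  ring

section Clocks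

variable {Ω : Type*} [MeasurableSpace Ω] {P : Measure Ω} {N : ℤ → ℝ≥0 → Ω → ℕ}
  [IsProbabilityMeasure P]

/-- Each step trades `h` of remaining time for one move of the walks at the cost of one step error,
and the errors telescope. -/
theorem IsClockFamily.norm_integral_meetingProb_walk_sub_le (hN : IsClockFamily N P) {h : ℝ≥0}
    (hh5 : (h : ℝ) * 5 ≤ 1) {a b : ℤ} (hba : b ≤ a) {m j : ℕ} (hj : j ≤ m) :
    ‖∫ ω, meetingProb ((m - j) * h)
        (walk (ringCount N h ω) a j - walk (ringCount N h ω) b j) ∂P -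
      meetingProb (m * h) (a - b)‖ ≤ j * (210 * Real.exp (5 * (m * h)) * h ^ 2) := by
  induction j with
  | zero => simp [walk]
  | succ j ih =>
    have ih := ih (by omega)
    set s : ℝ := (m - (j + 1 : ℕ)) * h with hs_def
    have hjm : ((j + 1 : ℕ) : ℝ) ≤ m := by exact_mod_cast hj
    have hs : 0 ≤ s := mul_nonneg (by linarith) h.2
    have hst : s ≤ m * h := mul_le_mul_of_nonneg_right (by linarith [(j + 1).cast_nonneg (α := ℝ)]) h.2
    have hsh : ((m : ℝ) - j) * h = s + h := by rw [hs_def]; push_cast; ring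
    have hsh' : s + h ≤ m * h := by
      rw [← hsh]; exact mul_le_mul_of_nonneg_right (by linarith [j.cast_nonneg (α := ℝ)]) h.2
    rw [hsh] at ih
    have hstep := hN.integral_walk_succ_sub h hba j
      (fun d hd => norm_meetingProb_le hs hst hd) (discreteLaplacian_meetingProb_zero s)
    have hi1 := hN.integrable_comp_walk_sub h hba j
      (fun d hd => norm_meetingProb_le hs hst hd)
    have hi2 := hN.integrable_comp_walk_sub h hba j
      (fun d hd => norm_discreteLaplacian_meetingProb_le hs hst hd)
    have hi3 := hN.integrable_comp_walk_sub h hba j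
      (fun d hd => norm_meetingProb_le (by positivity) hsh' hd)
    have hbound : ‖∫ ω, (meetingProb s (walk (ringCount N h ω) a j - walk (ringCount N h ω) b j) +
        ((1 - Real.exp (-h)) * Real.exp (-h) : ℝ) * discreteLaplacian (meetingProb s)
          (walk (ringCount N h ω) a j - walk (ringCount N h ω) b j)) ∂P -
        ∫ ω, meetingProb (s + h)
          (walk (ringCount N h ω) a j - walk (ringCount N h ω) b j) ∂P‖ ≤
        210 * Real.exp (5 * (m * h)) * h ^ 2 := by
      have hi12 : Integrable (fun ω =>
          meetingProb s (walk (ringCount N h ω) a j - walk (ringCount N h ω) b j) +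
          ((1 - Real.exp (-h)) * Real.exp (-h) : ℝ) * discreteLaplacian (meetingProb s)
            (walk (ringCount N h ω) a j - walk (ringCount N h ω) b j)) P :=
        hi1.add (hi2.const_mul _)
      rw [← integral_sub hi12 hi3]
      refine (norm_integral_le_of_norm_le_const (.of_forall fun ω =>
        norm_meetingProb_step_le hs hst h.2 hh5 (sub_nonneg.2 (walk_mono _ hba j)))).trans_eq ?_
      simp
    rw [hstep]
    calc _ ≤ _ := norm_sub_le_norm_sub_add_norm_sub _ (∫ ω, meetingProb (s + h)
          (walk (ringCount N h ω) a j - walk (ringCount N h ω) b j) ∂P) _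
      _ ≤ _ := add_le_add hbound ih
      _ = _ := by push_cast; ring

theorem IsClockFamily.norm_real_walk_eq_sub_le (hN : IsClockFamily N P) {h : ℝ≥0}
    (hh5 : (h : ℝ) * 5 ≤ 1) {a b : ℤ} (hba : b ≤ a) (m : ℕ) :
    ‖(P.real {ω | walk (ringCount N h ω) a m = walk (ringCount N h ω) b m} : ℂ) -
      meetingProb (m * h) (a - b)‖ ≤ m * (210 * Real.exp (5 * (m * h)) * h ^ 2) := by
  have key := hN.norm_integral_meetingProb_walk_sub_le hh5 hba (le_refl m)
  have hm : MeasurableSet {ω | walk (ringCount N h ω) a m = walk (ringCount N h ω) b m} :=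
    measurableSet_eq_fun (hN.measurable_walk_ringCount h a m) (hN.measurable_walk_ringCount h b m)
  -- With no time left, the initial data turn the integrand into the indicator of having met.
  have : ∀ ω, meetingProb ((m - m) * h)
      (walk (ringCount N h ω) a m - walk (ringCount N h ω) b m) =
      {ω | walk (ringCount N h ω) a m = walk (ringCount N h ω) b m}.indicator
        (fun _ => (1 : ℂ)) ω := fun ω => by
    rw [sub_self, zero_mul]
    rcases (walk_mono (ringCount N h ω) hba m).eq_or_lt with he | hl
    · simp [he, meetingProb_zero_zero]
    · simp [hl.ne', meetingProb_zero_of_pos (sub_pos.2 hl)]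
  simp_rw [this] at key
  rwa [integral_indicator_const _ hm, Complex.real_smul, mul_one] at key

end Clocks

/-! ### Almost sure properties of the clocks: fine grids and silent walls. -/

theorem poissonMeasure_real_Ici_two_le (h : ℝ≥0) :
    (poissonMeasure h).real (Set.Ici 2) ≤ (h : ℝ) ^ 2 := by
  have hc : (Set.Ici 2 : Set ℕ)ᶜ = {0} ∪ {1} := by ext n; simp; omega
  have h1 := probReal_add_probReal_compl (μ := poissonMeasure h) (s := Set.Ici 2) .of_discrete
  rw [hc, measureReal_union (by simp) .of_discrete, poissonMeasure_real_singleton,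
    poissonMeasure_real_singleton] at h1
  have h2 := Real.one_sub_le_exp_neg h
  have h3 : (0 : ℝ) ≤ h := h.2
  norm_num at h1
  nlinarith

section Clocks

variable {Ω : Type*} [MeasurableSpace Ω] {P : Measure Ω} {N : ℤ → ℝ≥0 → Ω → ℕ}

theorem IsClockFamily.real_two_le_ringCount_le (hN : IsClockFamily N P) (h : ℝ≥0) (j : ℕ)
    (x : ℤ) : P.real {ω | 2 ≤ ringCount N h ω j x} ≤ (h : ℝ) ^ 2 := by
  have := poissonMeasure_real_Ici_two_le h
  rwa [← hN.map_ringCount h j x,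
    map_measureReal_apply (hN.measurable_ringCount h j x) .of_discrete] at this

variable [IsProbabilityMeasure P]

theorem IsClockFamily.real_ringCount_ne_zero_inter_le (hN : IsClockFamily N P) (h : ℝ≥0) (j : ℕ)
    {x y : ℤ} (hxy : x ≠ y) :
    P.real {ω | ringCount N h ω j x ≠ 0 ∧ ringCount N h ω j y ≠ 0} ≤ (h : ℝ) ^ 2 := by
  have h1 : P.real {ω | ringCount N h ω j x ≠ 0 ∧ ringCount N h ω j y ≠ 0} =
      P.real {ω | ringCount N h ω j x ≠ 0} * P.real {ω | ringCount N h ω j y ≠ 0} :=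
    hN.real_inter_ringCount h j hxy {0}ᶜ {0}ᶜ
  rw [h1, hN.real_ringCount_ne_zero, hN.real_ringCount_ne_zero, ← sq]
  have h2 := Real.one_sub_le_exp_neg h
  have h3 : Real.exp (-h) ≤ 1 := Real.exp_le_one_iff.2 (by simp)
  exact pow_le_pow_left₀ (by linarith) (by linarith) 2

theorem IsClockFamily.real_not_atMostOneRing_le (hN : IsClockFamily N P) (h : ℝ≥0) (A B : ℤ)
    (j : ℕ) :
    P.real {ω | ¬ AtMostOneRing (fun x t => N x t ω) A B (j * h) ((j + 1 : ℕ) * h)} ≤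
      ((Finset.Icc A B).card + (Finset.Icc A B).card * (Finset.Icc A B).card) * (h : ℝ) ^ 2 := by
  set I := Finset.Icc A B
  have hsub : {ω | ¬ AtMostOneRing (fun x t => N x t ω) A B (j * h) ((j + 1 : ℕ) * h)} ⊆
      (⋃ c ∈ I, {ω | 2 ≤ ringCount N h ω j c}) ∪
        ⋃ p ∈ (I ×ˢ I).filter (fun p => p.1 ≠ p.2),
          {ω | ringCount N h ω j p.1 ≠ 0 ∧ ringCount N h ω j p.2 ≠ 0} := by
    intro ω hω
    by_contra hc
    refine hω ⟨fun c hcI => ?_, fun c hcI c' hcI' hne => ?_⟩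
    · by_contra h2
      exact hc (Or.inl (Set.mem_biUnion hcI (not_lt.1 h2)))
    · by_contra h2
      rw [not_or] at h2
      exact hc (Or.inr (Set.mem_biUnion (x := (c, c'))
        (Finset.mem_filter.2 ⟨Finset.mk_mem_product hcI hcI', hne⟩) h2))
  refine (measureReal_mono hsub).trans ((measureReal_union_le _ _).trans ?_)
  rw [add_mul]
  refine add_le_add ?_ ?_
  · refine (measureReal_biUnion_finset_le _ _).trans
      ((Finset.sum_le_card_nsmul _ _ _ fun c _ => hN.real_two_le_ringCount_le h j c).trans_eq ?_)
    rw [nsmul_eq_mul]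
  · refine (measureReal_biUnion_finset_le _ _).trans
      ((Finset.sum_le_card_nsmul _ _ ((h : ℝ) ^ 2) fun p hp =>
        hN.real_ringCount_ne_zero_inter_le h j (Finset.mem_filter.1 hp).2).trans ?_)
    rw [nsmul_eq_mul]
    refine mul_le_mul_of_nonneg_right ?_ (by positivity)
    exact_mod_cast (Finset.card_filter_le _ _).trans_eq (Finset.card_product I I)

/-- The grid with `(n + 1) ^ 2` cells on `[0, t]` is eventually so fine that the clocks of a finite
window ring at most once in each cell. -/
theorem IsClockFamily.ae_eventually_atMostOneRing (hN : IsClockFamily N P) (t : ℝ≥0) (A B : ℤ) :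
    ∀ᵐ ω ∂P, ∀ᶠ n : ℕ in atTop, ∀ j < (n + 1) ^ 2,
      AtMostOneRing (fun x t => N x t ω) A B (j * (t / ((n + 1) ^ 2 : ℕ)))
        ((j + 1 : ℕ) * (t / ((n + 1) ^ 2 : ℕ))) := by
  set K : ℝ := (Finset.Icc A B).card + (Finset.Icc A B).card * (Finset.Icc A B).card with hK
  set E : ℕ → Set Ω := fun n => ⋃ j ∈ Finset.range ((n + 1) ^ 2),
    {ω | ¬ AtMostOneRing (fun x t => N x t ω) A B (j * (t / ((n + 1) ^ 2 : ℕ)))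
        ((j + 1 : ℕ) * (t / ((n + 1) ^ 2 : ℕ)))} with hE
  -- A cell fails with probability at most `K h ^ 2`; squaring the number of cells makes the total
  -- `K t ^ 2 / (n + 1) ^ 2` summable for Borel–Cantelli.
  have hbound : ∀ n, P (E n) ≤ ENNReal.ofReal (K * t ^ 2 * (1 / ((n + 1 : ℕ) : ℝ) ^ 2)) := by
    intro n
    rw [← ofReal_measureReal (h := measure_ne_top _ _)]
    refine ENNReal.ofReal_le_ofReal ((measureReal_biUnion_finset_le _ _).trans
      ((Finset.sum_le_card_nsmul _ _ _ fun j _ =>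
        hN.real_not_atMostOneRing_le (t / ((n + 1) ^ 2 : ℕ)) A B j).trans_eq ?_))
    rw [Finset.card_range, nsmul_eq_mul, ← hK]
    have : ((n + 1 : ℕ) : ℝ) ≠ 0 := by positivity
    push_cast at this ⊢
    field_simp
  have hsum : ∑' n, P (E n) ≠ ⊤ := by
    refine ne_top_of_le_ne_top (Summable.tsum_ofReal_ne_top ?_) (ENNReal.tsum_le_tsum hbound)
    exact ((summable_nat_add_iff 1).2
      (Real.summable_one_div_nat_pow.2 one_lt_two)).mul_left (K * t ^ 2)
  filter_upwards [ae_eventually_notMem hsum] with ω hω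
  filter_upwards [hω] with n hn j hj
  by_contra hc
  exact hn (Set.mem_biUnion (Finset.mem_coe.2 (Finset.mem_range.2 hj)) hc)

/-- Second Borel–Cantelli: independent clocks each stay silent on `(0, t]` with the same positive
probability. Silent clocks serve as walls cutting the infinite system. -/
theorem IsClockFamily.ae_exists_ringCount_eq_zero (hN : IsClockFamily N P) (t : ℝ≥0) :
    ∀ᵐ ω ∂P, ∀ M : ℤ, ∃ B ≥ M, ringCount N t ω 0 B = 0 := by
  set s : ℕ → Set Ω := fun n => {ω | ringCount N t ω 0 n = 0} with hs
  have hms : ∀ n, MeasurableSet (s n) := fun n =>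
    hN.measurable_ringCount t 0 n (measurableSet_singleton 0)
  have hind : iIndepSet s P := by
    rw [iIndepSet_iff_meas_biInter hms]
    intro I
    have hi := (hN.iIndepFun_ringCount t).precomp (g := fun n : ℕ => ((n : ℤ), 0))
      (fun a b hab => by simpa using hab)
    exact hi.measure_inter_preimage_eq_mul I (sets := fun _ => {0}) fun _ _ => .of_discrete
  have hprob : ∀ n, P (s n) = ENNReal.ofReal (Real.exp (-t)) := fun n => by
    rw [← ofReal_measureReal, hN.real_ringCount_eq_zero t 0 n]
  have hlim := measure_limsup_eq_one hms hind (by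
    simp_rw [hprob]
    exact ENNReal.tsum_const_eq_top_of_ne_zero (by simp [Real.exp_pos]))
  have hae : ∀ᵐ ω ∂P, ω ∈ limsup s atTop :=
    (prob_compl_eq_zero_iff (MeasurableSet.measurableSet_limsup hms)).2 hlim
  filter_upwards [hae] with ω hω M
  rw [mem_limsup_iff_frequently_mem, frequently_atTop] at hω
  obtain ⟨n, hn, hmem⟩ := hω M.toNat
  exact ⟨n, by omega, hmem⟩

end Clocks

/-! ### Leaders, and the passage to the limit. -/

/-- A grid walk which is eventually the last site of type at least `k` in arbitrarily large windows
eventually sits at the position of the `k`-leader. -/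
theorem exists_leader_position {η : ℤ → ℤ} {k : ℤ} {W : ℕ → ℤ}
    (hW : ∀ M, ∃ B ≥ M, ∀ᶠ n in atTop, IsLastSite η k B (W n)) :
    ∃ x, k ≤ η x ∧ (∀ y, x < y → η y < k) ∧ ∀ᶠ n in atTop, W n = x := by
  obtain ⟨B, -, hB⟩ := hW 0
  obtain ⟨n₀, hn₀⟩ := hB.exists
  have hx : ∀ᶠ n in atTop, W n = W n₀ := hB.mono fun n hn => hn.unique hn₀
  refine ⟨W n₀, hn₀.1, fun y hy => ?_, hx⟩
  obtain ⟨B', hB', hev⟩ := hW y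
  obtain ⟨n, hn, hnx⟩ := (hev.and hx).exists
  exact hn.2.2 y (hnx ▸ hy) hB'

/-- A `k₁`-leader of type at least `k₂` is also rightmost among types at least `k₂`, so the two last
sites coincide; conversely, the particle at the common site is the witness. -/
theorem exists_isLeader_iff {η : ℤ → ℤ} {k₁ k₂ x₁ x₂ : ℤ} (hk : k₁ ≤ k₂) (h₁ : k₁ ≤ η x₁)
    (h₁' : ∀ y, x₁ < y → η y < k₁) (h₂ : k₂ ≤ η x₂) (h₂' : ∀ y, x₂ < y → η y < k₂) :
    (∃ i, k₂ ≤ i ∧ IsLeader η k₁ i) ↔ x₁ = x₂ := by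
  constructor
  · rintro ⟨_, hi, -, x, rfl, hx⟩
    have ha : x₁ ≤ x := hx (η x₁) h₁ x₁ rfl
    have hb : ¬ x₁ < x := fun h => by have := h₁' x h; omega
    have hc : x₂ ≤ x := hx (η x₂) (hk.trans h₂) x₂ rfl
    have hd : ¬ x₂ < x := fun h => by have := h₂' x h; omega
    omega
  · rintro rfl
    refine ⟨η x₁, h₂, h₁, x₁, rfl, ?_⟩
    rintro _ hz y rfl
    by_contra hc
    have := h₁' y (by omega)
    omega

section Tasep

variable {Ω : Type*} [MeasurableSpace Ω] {P : Measure Ω} {N : ℤ → ℝ≥0 → Ω → ℕ}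
  {η : ℝ≥0 → Ω → ℤ → ℤ}

theorem IsMultiTypeTasep.measurableSet_exists_isLeader (hη : IsMultiTypeTasep N η P) (t : ℝ≥0)
    (k₁ k₂ : ℤ) : MeasurableSet {ω | ∃ i, k₂ ≤ i ∧ IsLeader (η t ω) k₁ i} := by
  have : {ω | ∃ i, k₂ ≤ i ∧ IsLeader (η t ω) k₁ i} =
      ⋃ x, ({ω | max k₁ k₂ ≤ η t ω x} ∩ ⋂ y, {ω | k₁ ≤ η t ω y → y ≤ x}) := by
    ext ω
    simp only [IsLeader, Set.mem_ofPred_eq, Set.mem_iUnion, Set.mem_inter_iff, Set.mem_iInter]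
    constructor
    · rintro ⟨_, hi, hi', x, rfl, hx⟩
      exact ⟨x, max_le hi' hi, fun y hy => hx _ hy y rfl⟩
    · rintro ⟨x, hx, hy⟩
      exact ⟨_, (le_max_right _ _).trans hx, (le_max_left _ _).trans hx, x, rfl,
        fun z hz y hyz => hy y (hyz ▸ hz)⟩
  rw [this]
  refine MeasurableSet.iUnion fun x => MeasurableSet.inter ?_ (MeasurableSet.iInter fun y => ?_)
  · exact hη.measurable t x (.of_discrete (s := Set.Ici (max k₁ k₂)))
  · exact hη.measurable t y (.of_discrete (s := {i | k₁ ≤ i → y ≤ x}))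

variable [IsProbabilityMeasure P]

theorem IsMultiTypeTasep.ae_eventually_isLastSite (hη : IsMultiTypeTasep N η P) (t : ℝ≥0) (k : ℤ) :
    ∀ᵐ ω ∂P, ∀ M, ∃ B ≥ M, ∀ᶠ n : ℕ in atTop, IsLastSite (η t ω) k B
      (walk (ringCount N (t / ((n + 1) ^ 2 : ℕ)) ω) (-k) ((n + 1) ^ 2)) := by
  have hmono : ∀ᵐ ω ∂P, ∀ x, Monotone fun t => N x t ω :=
    ae_all_iff.2 fun x => (hη.clocks.clock x).monotone
  have hrc : ∀ᵐ ω ∂P, ∀ x t, ContinuousWithinAt (fun s => N x s ω) (Set.Ici t) t :=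
    ae_all_iff.2 fun x => (hη.clocks.clock x).rightCont
  have hgrid := ae_all_iff.2 fun B => hη.clocks.ae_eventually_atMostOneRing t (-k - 1) B
  filter_upwards [hmono, hrc, hgrid, hη.path, hη.clocks.ae_exists_ringCount_eq_zero t]
    with ω h1 h2 h3 h4 h5 M
  obtain ⟨B, hB, hB0⟩ := h5 (max M (-k))
  refine ⟨B, (le_max_left _ _).trans hB, ?_⟩
  filter_upwards [h3 B] with n hn
  have hmt : (((n + 1) ^ 2 : ℕ) : ℝ≥0) * (t / ((n + 1) ^ 2 : ℕ)) = t :=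
    mul_div_cancel₀ t (by positivity)
  have hstill : N B t ω = N B 0 ω := by
    have ha := h1 B (zero_le : 0 ≤ t)
    simp only [ringCount, zero_add, Nat.cast_one, one_mul, Nat.cast_zero, zero_mul] at hB0 ha
    omega
  have := h4.isLastSite_walk h1 h2 ((le_max_right _ _).trans hB) (by rwa [hmt]) hn
  rwa [hmt] at this

theorem IsMultiTypeTasep.real_exists_isLeader (hη : IsMultiTypeTasep N η P) (t : ℝ≥0)
    {k₁ k₂ : ℤ} (hk : k₁ ≤ k₂) :
    (P.real {ω | ∃ i, k₂ ≤ i ∧ IsLeader (η t ω) k₁ i} : ℂ) = meetingProb t (k₂ - k₁) := by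
  set m : ℕ → ℕ := fun n => (n + 1) ^ 2 with hm
  set E : ℕ → Set Ω := fun n => {ω | walk (ringCount N (t / m n) ω) (-k₁) (m n) =
    walk (ringCount N (t / m n) ω) (-k₂) (m n)} with hE
  have hE_meas : ∀ n, MeasurableSet (E n) := fun n =>
    measurableSet_eq_fun (hη.clocks.measurable_walk_ringCount _ _ _)
      (hη.clocks.measurable_walk_ringCount _ _ _)
  have hlim : Tendsto (fun n => P (E n)) atTop
      (𝓝 (P {ω | ∃ i, k₂ ≤ i ∧ IsLeader (η t ω) k₁ i})) := by
    -- Almost surely both grid walks eventually sit at the true leader positions, so the indicators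
    -- are eventually equal.
    refine tendsto_measure_of_ae_tendsto_indicator_of_isFiniteMeasure atTop
      (hη.measurableSet_exists_isLeader t k₁ k₂) hE_meas ?_
    filter_upwards [hη.ae_eventually_isLastSite t k₁, hη.ae_eventually_isLastSite t k₂]
      with ω h₁ h₂
    obtain ⟨x₁, ha, ha', hw₁⟩ := exists_leader_position h₁
    obtain ⟨x₂, hb, hb', hw₂⟩ := exists_leader_position h₂
    filter_upwards [hw₁, hw₂] with n hn₁ hn₂
    rw [Set.mem_ofPred_eq, exists_isLeader_iff hk ha ha' hb hb', ← hn₁, ← hn₂]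
  have hlim' : Tendsto (fun n => (P.real (E n) : ℂ)) atTop
      (𝓝 (P.real {ω | ∃ i, k₂ ≤ i ∧ IsLeader (η t ω) k₁ i} : ℂ)) :=
    (Complex.continuous_ofReal.tendsto _).comp
      ((ENNReal.tendsto_toReal (measure_ne_top _ _)).comp hlim)
  have hm_top : Tendsto (fun n => (m n : ℝ)) atTop atTop :=
    tendsto_natCast_atTop_atTop.comp ((tendsto_pow_atTop two_ne_zero).comp
      (tendsto_add_atTop_nat 1))
  have hzero : ∀ c : ℝ, Tendsto (fun n => c / m n) atTop (𝓝 0) := fun c =>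
    hm_top.const_div_atTop c
  refine tendsto_nhds_unique hlim' (tendsto_iff_norm_sub_tendsto_zero.2 ?_)
  refine squeeze_zero' (.of_forall fun _ => norm_nonneg _) ?_
    (hzero (210 * Real.exp (5 * t) * t ^ 2))
  -- The Taylor bound needs `5 h ≤ 1`, true on fine grids; `m` step errors of order `(t / m) ^ 2`
  -- then sum to order `1 / m`.
  filter_upwards [(hzero (t * 5)).eventually (Iic_mem_nhds zero_lt_one)] with n hn
  have hmn : (m n : ℝ) ≠ 0 := by simp only [hm]; positivity
  have hcast : ((t / m n : ℝ≥0) : ℝ) = t / m n := by push_cast; rfl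
  have hmt : (m n : ℝ) * (t / m n : ℝ≥0) = t := by rw [hcast]; field_simp
  have key := hη.clocks.norm_real_walk_eq_sub_le (h := t / m n)
    (by rw [hcast, div_mul_eq_mul_div]; exact hn) (show -k₂ ≤ -k₁ by omega) (m n)
  rw [hmt, show -k₁ - -k₂ = k₂ - k₁ by ring] at key
  refine key.trans_eq ?_
  rw [hcast]
  field_simp

end Tasep

theorem proposition4p1 {Ω : Type*} [MeasurableSpace Ω] (P : Measure Ω) [IsProbabilityMeasure P]
    (N : ℤ → ℝ≥0 → Ω → ℕ) (η : ℝ≥0 → Ω → ℤ → ℤ) (hη : IsMultiTypeTasep N η P)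
    (t : ℝ≥0) (k₁ k₂ : ℤ) (hk : k₁ < k₂) (R : ℝ) (hR : 1 < R) :
    ((P.real {ω | ∃ i, k₂ ≤ i ∧ IsLeader (η t ω) k₁ i} : ℝ) : ℂ) =
      1 / (2 * (Real.pi : ℂ) * Complex.I) *
        ∮ w in C(0, R), (w + 2) / w * (1 + w) ^ (k₁ - k₂ - 1) *
          Complex.exp ((t : ℂ) * w ^ 2 / (1 + w)) := by
  have h := circleIntegral_contourIntegrand t (k₂ - k₁) hR
  rw [hη.real_exists_isLeader t hk.le, meetingProb, ← h, smul_eq_mul, one_div]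
  simp only [contourIntegrand, neg_sub]
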